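/- Let $(R,\mathfrak m)$ be a Noetherian local ring with infinite residue field, $\mathfrak q$ an $\mathfrak m$-primary ideal, and $M$ a finitely generated $R$-module of dimension $d\ge 2$ with $\operatorname{depth} M\ge d-1$. Write $\lambda$ for length. Let $\mathbb M=\{M_n\}_{n\ge 0}$ be a good $\mathfrak q$-filtration of $M$: $M=M_0\supseteq M_1\supseteq\cdots$ are submodules, $\mathfrak qM_n\subseteq M_{n+1}$ for all $n$, and $\mathfrak qM_n=M_{n+1}$ for $n\gg0$. For a submodule $N$ of $M$ let $\mathbb M/N=\{(M_n+N)/N\}_{n\ge 0}$ be the induced filtration of $M/N$. For a good $\mathfrak q$-filtration $\mathbb L=\{L_n\}$ of a finitely generated module $L$ of dimension $r$ put $H_{\mathbb L}(n)=\lambda(L_n/L_{n+1})$ for $n\ge 0$ and $H_{\mathbb L}(n)=0$ for $n<0$, write $\sum_{n\ge0}H_{\mathbb L}(n)t^n=h_{\mathbb L}(t)/(1-t)^r$ with $h_{\mathbb L}\in\mathbb Z[t]$, and set $e_i(\mathbb L)=h_{\mathbb L}^{(i)}(1)/i!$ for $i\ge0$ and $p_{\mathbb L}(X)=\sum_{i=0}^{r-1}(-1)^ie_i(\mathbb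 L)\binom{X+r-i-1}{r-i-1}$. The postulation number of $\mathbb L$ is the largest integer $n$ with $H_{\mathbb L}(n)\ne p_{\mathbb L}(n)$. The Ratliff–Rush filtration $\widetilde{\mathbb L}$ of $\mathbb L$ has terms $\widetilde L_n=\bigcup_{k\ge1}(L_{n+k}:_L\mathfrak q^k)$. An element $a\in\mathfrak q$ is $\mathbb L$-superficial for $\mathfrak q$ if there is $c\ge0$ with $(L_{n+1}:_La)\cap L_c=L_n$ for all $n\ge c$. Let $a_1,\dots,a_d$ be a maximal $\mathbb M$-superficial sequence for $\mathfrak q$, that is, a sequence of length $d=\dim M$ such that $a_i$ is $\mathbb M/(a_1,\dots,a_{i-1})M$-superficial for $\mathfrak q$ for each $i=1,\dots,d$. Then the postulation number $s$ of the Ratliff–Rush filtration of $\mathbb M/(a_1,\dots,a_{d-2})M$ exists, the length below is finite, and $$e_2(\mathbb M)\;\ge\;-\binom{s+2}{2}\,\lambda\!\left(\frac{(a_1,\dots,a_{d-1})M:_Ma_d}{(a_1,\dots,a_{d-1})M}\right).$$ -/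

import Mathlib

noncomputable section

/-- The colon submodule `N :_M a = {x ∈ M : a x ∈ N}`. -/
def Submodule.colonElem {R M : Type*} [CommRing R] [AddCommGroup M] [Module R M]
    (N : Submodule R M) (a : R) : Submodule R M :=
  N.comap (LinearMap.lsmul R M a)

/-- The length of `P / (N ∩ P)`; this is `λ(P / N)` when `N ≤ P`. -/
def Submodule.relLength {R M : Type*} [CommRing R] [AddCommGroup M] [Module R M]
    (P N : Submodule R M) : ℕ∞ :=
  Module.length R (P ⧸ N.submoduleOf P)

/-- The dimension of a module as a natural number (for modules of finite Krull dimension;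
the zero module gets `0`). -/
def Module.natDim (R M : Type*) [CommRing R] [AddCommGroup M] [Module R M] : ℕ :=
  ((Module.supportDim R M).unbotD 0).toNat

/-- The depth of a module over a local ring: the supremum of the lengths of the regular sequences
on `M` that consist of elements of the maximal ideal. -/
def IsLocalRing.moduleDepth (R M : Type*) [CommRing R] [IsLocalRing R] [AddCommGroup M]
    [Module R M] : ℕ∞ :=
  ⨆ rs ∈ {rs : List R | RingTheory.Sequence.IsRegular M rs ∧
    ∀ r ∈ rs, r ∈ IsLocalRing.maximalIdeal R}, (rs.length : ℕ∞)

/-- The ideal generated by the first `k` elements of `a`. -/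
def Ideal.ofFirst {R : Type*} [CommRing R] {r : ℕ} (a : Fin r → R) (k : ℕ) : Ideal R :=
  Ideal.span (a '' {j | (j : ℕ) < k})

namespace Ideal.Filtration

variable {R M : Type*} [CommRing R] [AddCommGroup M] [Module R M] {q : Ideal R}

/-- A good `q`-filtration of `M`: it starts at `M`, and `q M_n = M_{n+1}` for `n ≫ 0`. -/
def IsGood (F : q.Filtration M) : Prop :=
  F.N 0 = ⊤ ∧ F.Stable

/-- The filtration `{(M_n + N) / N}` of `M / N`. -/
def quotient (F : q.Filtration M) (N : Submodule R M) : q.Filtration (M ⧸ N) where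
  N n := (F.N n).map N.mkQ
  mono n := Submodule.map_mono (F.mono n)
  smul_le n := by
    rw [← Submodule.map_smul'']
    exact Submodule.map_mono (F.smul_le n)

/-- The Ratliff-Rush filtration: its `n`-th term is the union over `k ≥ 1` of the submodules
`M_{n+k} :_M q^k`. -/
def ratliffRush (F : q.Filtration M) : q.Filtration M where
  N n :=
    { carrier := {x | ∃ k : ℕ, 1 ≤ k ∧ ∀ r ∈ q ^ k, r • x ∈ F.N (n + k)}
      zero_mem' := ⟨1, le_rfl, fun r _ => by simp⟩
      add_mem' := by
        have key : ∀ {x : M} {k l : ℕ}, (∀ r ∈ q ^ k, r • x ∈ F.N (n + k)) →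
            ∀ r ∈ q ^ (k + l), r • x ∈ F.N (n + (k + l)) := by
          intro x k l h r hr
          rw [add_comm k l, pow_add] at hr
          refine Submodule.mul_induction_on hr (fun s hs t ht => ?_) (fun s t hs ht => ?_)
          · rw [mul_smul, show n + (k + l) = l + (n + k) by omega]
            exact F.pow_smul_le l (n + k) (Submodule.smul_mem_smul hs (h t ht))
          · rw [add_smul]
            exact add_mem hs ht
        rintro x y ⟨k, hk, hx⟩ ⟨l, _, hy⟩
        refine ⟨k + l, by omega, fun r hr => ?_⟩
        rw [smul_add]
        refine add_mem (key hx r hr) ?_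
        rw [add_comm k l] at hr ⊢
        exact key hy r hr
      smul_mem' := by
        rintro c x ⟨k, hk, hx⟩
        refine ⟨k, hk, fun r hr => ?_⟩
        rw [smul_comm]
        exact Submodule.smul_mem _ c (hx r hr) }
  mono n := by
    rintro x ⟨k, hk, hx⟩
    exact ⟨k, hk, fun r hr => F.antitone (by omega) (hx r hr)⟩
  smul_le n := by
    rw [Submodule.smul_le]
    rintro c hc x ⟨k, hk, hx⟩
    refine ⟨k, hk, fun r hr => ?_⟩
    rw [smul_comm, show n + 1 + k = n + k + 1 by omega]
    exact F.smul_le _ (Submodule.smul_mem_smul hc (hx r hr))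

/-- `a ∈ q` is superficial: for some `c`, `(M_{n+1} :_M a) ∩ M_c = M_n` for all `n ≥ c`. -/
def IsSuperficial (F : q.Filtration M) (a : R) : Prop :=
  a ∈ q ∧ ∃ c : ℕ, ∀ n ≥ c, (F.N (n + 1)).colonElem a ⊓ F.N c = F.N n

/-- A superficial sequence: each element is superficial for the filtration induced on the quotient
of `M` by the preceding elements. -/
def IsSuperficialSeq (F : q.Filtration M) {r : ℕ} (a : Fin r → R) : Prop :=
  ∀ i : Fin r, (F.quotient (Ideal.ofFirst a i • (⊤ : Submodule R M))).IsSuperficial (a i)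

/-- The Hilbert function `n ↦ λ(M_n / M_{n+1})`. -/
def hilbertFun (F : q.Filtration M) (n : ℕ) : ℕ :=
  ((F.N n).relLength (F.N (n + 1))).toNat

/-- The Hilbert series. -/
def hilbertSeries (F : q.Filtration M) : PowerSeries ℤ :=
  PowerSeries.mk fun n => (F.hilbertFun n : ℤ)

open Classical in
/-- The `h`-polynomial: the polynomial `h` with `P(t) = h(t) / (1 - t)^(dim M)`, where `P` is the
Hilbert series. It exists and is unique for a good filtration of a finitely generated module
over a Noetherian local ring with respect to an ideal primary to the maximal ideal. -/
def hPoly (F : q.Filtration M) : Polynomial ℤ :=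
  if h : ∃ p : Polynomial ℤ, (p : PowerSeries ℤ) =
      (1 - PowerSeries.X) ^ Module.natDim R M * F.hilbertSeries
  then h.choose else 0

/-- The Hilbert coefficient `e_i = h^(i)(1) / i!`. -/
def hilbertCoeff (F : q.Filtration M) (i : ℕ) : ℤ :=
  (Polynomial.hasseDeriv i F.hPoly).eval 1

/-- The Hilbert polynomial
`∑_{i < d} (-1)^i e_i * binom(X + d - i - 1, d - i - 1)`, where `d = dim M`. Here
`Polynomial.preHilbertPoly ℚ m 0` is `binom(X + m, m)`. -/
def hilbertPolynomial (F : q.Filtration M) : Polynomial ℚ :=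
  ∑ i ∈ Finset.range (Module.natDim R M),
    Polynomial.C ((-1) ^ i * (F.hilbertCoeff i : ℚ)) *
      Polynomial.preHilbertPoly ℚ (Module.natDim R M - i - 1) 0

/-- The Hilbert function on all integers; it vanishes at negative ones. -/
def hilbertFunInt (F : q.Filtration M) (n : ℤ) : ℕ :=
  if 0 ≤ n then F.hilbertFun n.toNat else 0

/-- `s` is the postulation number: the largest integer at which the Hilbert function and the
Hilbert polynomial disagree. -/
def IsPostulationNumber (F : q.Filtration M) (s : ℤ) : Prop :=
  IsGreatest {n : ℤ | (F.hilbertFunInt n : ℚ) ≠ F.hilbertPolynomial.eval (n : ℚ)} s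

end Ideal.Filtration

end

/-! Since depth M ≥ d − 1, superficiality makes `a_1, …, a_{d-1}` a regular sequence
(`regular_tower`). Dividing by a superficial regular element preserves `e_i` for every i up to the
dimension of the quotient (`hilbertCoeff_eq_of_isSMulRegular`), so `e_2` survives division by `a_1,
…, a_{d-2}`. It remains to treat dimension 2 with `a = a_{d-1}` regular, `b = a_d`, `N = M/aM`.

The Ratliff–Rush filtration agrees with the given one in large degrees, hence has the same `e_2`,
and its colons by `a` are exact in every degree (`ratliffRush_colonElem`). So its Hilbert function
is `H(n) = ∑_{i ≤ n} h(i)`, with `h` the Hilbert function of its image in the one-dimensional module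
`N`. Let `l = λ(0 :_N b)`, which is the length in the theorem. Then `h(n) ≤ λ(N/bN)` always and
`h(n) = λ(N/bN) - l = e` for n ≫ 0 (`hilbertFun_add_length_torsionBy`), so `δ_j = e - h(j)`
satisfies `δ_j ≥ -l`.

Expanding the numerator of the series at 1 gives `e_2 = ∑ j δ_j`. The difference of Hilbert function
and polynomial at `m - 1` is `∑_{j ≥ m} δ_j`, so `δ_j = 0` for `j ≥ s + 2`. Hence `e_2 ≥ -l ∑_{j <
s+2} j`, which is the bound (`exists_isPostulationNumber_of_dim_two`). -/

open Pointwise RingTheory.Sequence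

/-! ### Depth and dimension modulo a regular element. -/

section DepthAndDimension

universe u v

-- Depth is read off from the vanishing of Ext in low degrees. In the long exact sequence of
-- multiplication by `x`, the group `Ext^i` into `M/xM` lies between those of degrees `i` and `i +
-- 1` into `M`, so at most one degree is lost.
open CategoryTheory Abelian in
theorem ModuleCat.exists_isRegular_quotSMulTop {R : Type u} [CommRing R] [IsLocalRing R]
    [IsNoetherianRing R] (M : ModuleCat.{max u v} R) [Module.Finite R M] [Nontrivial M]
    {x : R} (hx : x ∈ IsLocalRing.maximalIdeal R) (hreg : IsSMulRegular M x) {n : ℕ}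
    (h : ∃ rs : List R, rs.length = n + 1 ∧ (∀ r ∈ rs, r ∈ IsLocalRing.maximalIdeal R) ∧
      IsRegular M rs) :
    ∃ rs : List R, rs.length = n ∧ (∀ r ∈ rs, r ∈ IsLocalRing.maximalIdeal R) ∧
      IsRegular (QuotSMulTop x M) rs := by
  have lt : ∀ (L : Type (max u v)) [AddCommGroup L] [Module R L] [Module.Finite R L]
      [Nontrivial L], IsLocalRing.maximalIdeal R • (⊤ : Submodule R L) < ⊤ := fun L _ _ _ _ =>
    (Submodule.top_ne_ideal_smul_of_le_jacobson_annihilator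
      (IsLocalRing.maximalIdeal_le_jacobson _)).symm.lt_top
  have : Nontrivial (QuotSMulTop x M) := nontrivial_quotSMulTop_of_mem_maximalIdeal M hx
  have h1 := ((ModuleCat.exists_isRegular_tfae (IsLocalRing.maximalIdeal R) (n + 1) M
    (lt M)).out 3 1).mp h
  refine ((ModuleCat.exists_isRegular_tfae (IsLocalRing.maximalIdeal R) n
    (ModuleCat.of R (QuotSMulTop x M)) (lt _)).out 1 3).mp fun i hi => ?_
  have zero1 := AddCommGrpCat.isZero_of_iff_subsingleton.mpr (h1 i (by omega))
  have zero2 := AddCommGrpCat.isZero_of_iff_subsingleton.mpr (h1 (i + 1) (by omega))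
  exact AddCommGrpCat.subsingleton_of_isZero <| ShortComplex.Exact.isZero_of_both_zeros
    ((Ext.covariant_sequence_exact₃' _ hreg.smulShortComplex_shortExact) i (i + 1) rfl)
    (zero1.eq_zero_of_src _) (zero2.eq_zero_of_tgt _)

variable {R : Type u} [CommRing R]

section

variable {M N : Type*} [AddCommGroup M] [Module R M] [AddCommGroup N] [Module R N]

/-- A surjection with kernel `a M` identifies its target with `M / a M`. -/
noncomputable def LinearMap.quotSMulTopEquiv (f : M →ₗ[R] N) (hf : Function.Surjective f) {a : R}
    (hker : LinearMap.ker f = a • (⊤ : Submodule R M)) : QuotSMulTop a M ≃ₗ[R] N :=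
  (Submodule.quotEquivOfEq _ _ hker.symm).trans (f.quotKerEquivOfSurjective hf)

theorem LinearMap.mem_range_smul_of_ker_eq {f : M →ₗ[R] N} {a : R}
    (hker : LinearMap.ker f = a • (⊤ : Submodule R M)) {x : M} :
    f x = 0 ↔ ∃ y, a • y = x := by
  rw [← LinearMap.mem_ker, hker, Submodule.mem_smul_pointwise_iff_exists]
  simp

end

variable {M : Type v} [AddCommGroup M] [Module R M]

theorem Module.natDim_eq {n : ℕ} (h : Module.supportDim R M = n) : Module.natDim R M = n := by
  unfold Module.natDim
  rw [h]
  rfl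

theorem Module.length_ne_top_of_supportDim_le_zero [IsNoetherianRing R] [Module.Finite R M]
    (h : Module.supportDim R M ≤ 0) : Module.length R M ≠ ⊤ := by
  rw [Module.supportDim_eq_ringKrullDim_quotient_annihilator] at h
  have : Ring.KrullDimLE 0 (R ⧸ Module.annihilator R M) := by
    rwa [Ring.KrullDimLE, Order.krullDimLE_iff]
  have : IsArtinianRing (R ⧸ Module.annihilator R M) :=
    isArtinianRing_iff_krullDimLE_zero.mpr this
  let _ : Module (R ⧸ Module.annihilator R M) M := Module.quotientAnnihilator
  have : IsScalarTower R (R ⧸ Module.annihilator R M) M :=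
    Module.IsTorsionBySet.isScalarTower _
  have : Module.Finite (R ⧸ Module.annihilator R M) M :=
    Module.Finite.of_restrictScalars_finite R _ _
  rw [Module.length_eq_of_surjective (R := R ⧸ Module.annihilator R M)
    Ideal.Quotient.mk_surjective]
  exact Module.length_ne_top

/-- There is a regular sequence of length `n` on `M` in the maximal ideal. -/
def IsLocalRing.HasRegularSeq (R : Type*) [CommRing R] [IsLocalRing R] (M : Type*)
    [AddCommGroup M] [Module R M] (n : ℕ) : Prop :=
  ∃ rs : List R, rs.length = n ∧ (∀ r ∈ rs, r ∈ IsLocalRing.maximalIdeal R) ∧ IsRegular M rs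

variable [IsLocalRing R]

theorem LinearEquiv.hasRegularSeq {N : Type*} [AddCommGroup N] [Module R N] (e : M ≃ₗ[R] N)
    {n : ℕ} (h : IsLocalRing.HasRegularSeq R M n) : IsLocalRing.HasRegularSeq R N n := by
  obtain ⟨rs, h1, h2, h3⟩ := h
  exact ⟨rs, h1, h2, (e.isRegular_congr rs).mp h3⟩

theorem IsLocalRing.HasRegularSeq.nontrivial {n : ℕ} (h : IsLocalRing.HasRegularSeq R M n) :
    Nontrivial M := by
  obtain ⟨rs, h1, h2, h3⟩ := h
  exact h3.nontrivial

theorem IsLocalRing.HasRegularSeq.exists_isSMulRegular {n : ℕ}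
    (h : IsLocalRing.HasRegularSeq R M (n + 1)) :
    ∃ y ∈ IsLocalRing.maximalIdeal R, IsSMulRegular M y := by
  obtain ⟨rs, h1, h2, h3⟩ := h
  match rs with
  | [] => simp at h1
  | y :: rs => exact ⟨y, h2 y (by simp), ((isRegular_cons_iff M y rs).mp h3).1⟩

theorem IsLocalRing.HasRegularSeq.quotSMulTop [IsNoetherianRing R] [Module.Finite R M] {n : ℕ}
    (h : IsLocalRing.HasRegularSeq R M (n + 1)) {x : R} (hx : x ∈ IsLocalRing.maximalIdeal R)
    (hreg : IsSMulRegular M x) : IsLocalRing.HasRegularSeq R (QuotSMulTop x M) n := by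
  have := h.nontrivial
  -- The Ext argument needs the module in a universe containing that of `R`.
  let e : ULift.{u} M ≃ₗ[R] M := ULift.moduleEquiv
  have h' : IsLocalRing.HasRegularSeq R (QuotSMulTop x (ULift.{u} M)) n :=
    ModuleCat.exists_isRegular_quotSMulTop.{u, v} (ModuleCat.of R (ULift.{u} M)) hx
      ((e.isSMulRegular_congr x).mpr hreg) (e.symm.hasRegularSeq h)
  exact (QuotSMulTop.congr x e).hasRegularSeq h'

theorem IsLocalRing.hasRegularSeq_of_le_moduleDepth [IsNoetherianRing R] [Module.Finite R M]
    [Nontrivial M] {n : ℕ} (h : (n : ℕ∞) ≤ IsLocalRing.moduleDepth R M) :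
    IsLocalRing.HasRegularSeq R M n := by
  obtain _ | n := n
  · exact ⟨[], rfl, by simp, IsRegular.nil R M⟩
  · have h1 : (n : ℕ∞) < IsLocalRing.moduleDepth R M :=
      lt_of_lt_of_le (by exact_mod_cast Nat.lt_succ_self n) h
    unfold IsLocalRing.moduleDepth at h1
    simp only [lt_iSup_iff] at h1
    obtain ⟨rs, ⟨h2, h3⟩, h4⟩ := h1
    have h5 : n < rs.length := by exact_mod_cast h4
    -- The supremum only yields some sequence longer than `n`; its initial segment of length `n + 1`
    -- is used.
    refine ⟨rs.take (n + 1), by simp; omega, fun r hr => h3 r (List.mem_of_mem_take hr), ?_⟩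
    refine IsRegular.of_isWeaklyRegular_of_mem_maximalIdeal M
      (fun r hr => h3 r (List.mem_of_mem_take hr)) ?_
    have h6 := h2.toIsWeaklyRegular
    rw [← List.take_append_drop (n + 1) rs, isWeaklyRegular_append_iff] at h6
    exact h6.1

theorem Module.supportDim_of_surjective_of_isSMulRegular [IsNoetherianRing R] [Module.Finite R M]
    {N : Type*} [AddCommGroup N] [Module R N] {f : M →ₗ[R] N} (hf : Function.Surjective f) {a : R}
    (hker : LinearMap.ker f = a • (⊤ : Submodule R M)) (hreg : IsSMulRegular M a)
    (ha : a ∈ IsLocalRing.maximalIdeal R) {n : ℕ} (h : Module.supportDim R M = (n + 1 : ℕ)) :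
    Module.supportDim R N = n := by
  rw [← Module.supportDim_quotSMulTop_succ_eq_supportDim hreg ha,
    Module.supportDim_eq_of_equiv (f.quotSMulTopEquiv hf hker)] at h
  push_cast at h
  exact (ENat.WithBot.add_one_cancel).mp h

theorem Module.supportDim_le_zero_of_pow_smul_eq_bot {q : Ideal R}
    (hq : q.radical = IsLocalRing.maximalIdeal R) {n : ℕ}
    (h : q ^ n • (⊤ : Submodule R M) = ⊥) : Module.supportDim R M ≤ 0 := by
  have key : ∀ p ∈ Module.support R M, p.asIdeal = IsLocalRing.maximalIdeal R := by
    intro p hp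
    refine le_antisymm (IsLocalRing.le_maximalIdeal p.2.ne_top) ?_
    rw [← hq, p.2.radical_le_iff]
    have h1 : q ^ n ≤ Module.annihilator R M := by
      intro r hr
      rw [Module.mem_annihilator]
      intro x
      have := Submodule.smul_mem_smul hr (Submodule.mem_top (x := x))
      rwa [h, Submodule.mem_bot] at this
    exact Ideal.IsPrime.le_of_pow_le (h1.trans (Module.annihilator_le_of_mem_support hp))
  have : Subsingleton (Module.support R M) :=
    ⟨fun x y => Subtype.ext (PrimeSpectrum.ext ((key x x.2).trans (key y y.2).symm))⟩
  exact Order.krullDim_nonpos_of_subsingleton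

end DepthAndDimension

/-! ### Good filtrations and superficial elements. -/

namespace Ideal.Filtration

variable {R M N : Type*} [CommRing R] [AddCommGroup M] [Module R M] [AddCommGroup N] [Module R N]
  {q : Ideal R}

/-- The image of a filtration under a linear map. -/
def map (F : q.Filtration M) (f : M →ₗ[R] N) : q.Filtration N where
  N n := (F.N n).map f
  mono n := Submodule.map_mono (F.mono n)
  smul_le n := by
    rw [← Submodule.map_smul'']
    exact Submodule.map_mono (F.smul_le n)

theorem IsGood.map {F : q.Filtration M} (hF : F.IsGood) {f : M →ₗ[R] N}
    (hf : Function.Surjective f) : (F.map f).IsGood := by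
  obtain ⟨h0, n₀, hn⟩ := hF
  refine ⟨?_, n₀, fun n h => ?_⟩
  · change (F.N 0).map f = ⊤
    rw [h0, Submodule.map_top, LinearMap.range_eq_top.mpr hf]
  · change q • (F.N n).map f = (F.N (n + 1)).map f
    rw [← Submodule.map_smul'', hn n h]

theorem IsGood.quotient {F : q.Filtration M} (hF : F.IsGood) (L : Submodule R M) :
    (F.quotient L).IsGood :=
  hF.map L.mkQ_surjective

theorem pow_smul_top_le {F : q.Filtration M} (h0 : F.N 0 = ⊤) (n : ℕ) :
    q ^ n • (⊤ : Submodule R M) ≤ F.N n := by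
  simpa [h0] using F.pow_smul_le n 0

theorem smul_mem_succ (F : q.Filtration M) {a : R} (ha : a ∈ q) {n : ℕ} {x : M}
    (hx : x ∈ F.N n) : a • x ∈ F.N (n + 1) :=
  F.smul_le n (Submodule.smul_mem_smul ha hx)

theorem le_colonElem (F : q.Filtration M) {a : R} (ha : a ∈ q) (n : ℕ) :
    F.N n ≤ (F.N (n + 1)).colonElem a :=
  fun _ hx => F.smul_mem_succ ha hx

theorem le_ratliffRush (F : q.Filtration M) (n : ℕ) : F.N n ≤ F.ratliffRush.N n :=
  fun _ hx => ⟨1, le_rfl, fun r hr => F.smul_mem_succ (by simpa using hr) hx⟩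

theorem ratliffRush_zero {F : q.Filtration M} (h0 : F.N 0 = ⊤) : F.ratliffRush.N 0 = ⊤ :=
  top_le_iff.mp (h0 ▸ F.le_ratliffRush 0)

/-- Artin–Rees: for large `n` the intersection is `q^(n-k)` times a submodule of `aM`, hence inside
`q^c aM = a q^c M`. -/
theorem IsGood.exists_inf_smul_top_le [IsNoetherianRing R] [Module.Finite R M]
    {F : q.Filtration M} (hF : F.IsGood) (a : R) (c : ℕ) :
    ∃ n₀, ∀ n ≥ n₀, F.N n ⊓ a • (⊤ : Submodule R M) ≤ a • F.N c := by
  obtain ⟨k, hk⟩ := (hF.2.inter_right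
    (q.trivialFiltration (a • (⊤ : Submodule R M)))).exists_pow_smul_eq_of_ge
  refine ⟨k + c, fun n hn => ?_⟩
  have h1 := hk n (by omega)
  change F.N n ⊓ a • (⊤ : Submodule R M) = q ^ (n - k) • (F.N k ⊓ a • (⊤ : Submodule R M)) at h1
  rw [h1]
  calc q ^ (n - k) • (F.N k ⊓ a • (⊤ : Submodule R M))
      ≤ q ^ c • (a • (⊤ : Submodule R M)) :=
        Submodule.smul_mono (Ideal.pow_le_pow_right (by omega)) inf_le_right
    _ = a • (q ^ c • (⊤ : Submodule R M)) :=
        (Submodule.map_smul'' _ _ _).symm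
    _ ≤ a • F.N c := Submodule.map_mono (pow_smul_top_le hF.1 c)

/-- Artin–Rees supplies a representative `y` in `M_c`, where the defining condition of
superficiality applies; this removes the intersection with `M_c`. -/
theorem IsSuperficial.exists_mem_of_smul_mem [IsNoetherianRing R] [Module.Finite R M]
    {F : q.Filtration M} (hF : F.IsGood) {a : R} (ha : F.IsSuperficial a) :
    ∃ n₀, ∀ n ≥ n₀, ∀ x : M, a • x ∈ F.N (n + 1) → ∃ y ∈ F.N n, a • y = a • x := by
  obtain ⟨haq, c, hc⟩ := ha
  obtain ⟨k, hk⟩ := hF.exists_inf_smul_top_le a c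
  refine ⟨k + c, fun n hn x hx => ?_⟩
  obtain ⟨y, hy, hyx⟩ := (Submodule.mem_smul_pointwise_iff_exists _ _ _).mp
    (hk (n + 1) (by omega) ⟨hx, Submodule.smul_mem_pointwise_smul x a _ Submodule.mem_top⟩)
  refine ⟨y, ?_, hyx⟩
  rw [← hc n (by omega)]
  exact ⟨show a • y ∈ _ by rwa [hyx], hy⟩

theorem IsSuperficial.exists_colonElem_eq [IsNoetherianRing R] [Module.Finite R M]
    {F : q.Filtration M} (hF : F.IsGood) {a : R} (ha : F.IsSuperficial a)
    (hreg : IsSMulRegular M a) : ∃ n₀, ∀ n ≥ n₀, (F.N (n + 1)).colonElem a = F.N n := by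
  obtain ⟨n₀, h⟩ := ha.exists_mem_of_smul_mem hF
  refine ⟨n₀, fun n hn => le_antisymm (fun x hx => ?_) (F.le_colonElem ha.1 n)⟩
  obtain ⟨y, hy, hyx⟩ := h n hn x hx
  rwa [← hreg hyx]

section Local

variable [IsLocalRing R]

theorem length_quotient_ne_top [IsNoetherianRing R] [Module.Finite R M]
    (hq : q.radical = IsLocalRing.maximalIdeal R) {F : q.Filtration M} (h0 : F.N 0 = ⊤) (n : ℕ) :
    Module.length R (M ⧸ F.N n) ≠ ⊤ := by
  refine Module.length_ne_top_of_supportDim_le_zero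
    (Module.supportDim_le_zero_of_pow_smul_eq_bot hq (n := n) ?_)
  rw [eq_bot_iff, Submodule.smul_le]
  intro r hr x _
  obtain ⟨y, rfl⟩ := Submodule.Quotient.mk_surjective _ x
  rw [Submodule.mem_bot, ← Submodule.Quotient.mk_smul, Submodule.Quotient.mk_eq_zero]
  exact pow_smul_top_le h0 n (Submodule.smul_mem_smul hr Submodule.mem_top)

theorem _root_.Ideal.ne_top_of_radical_eq_maximalIdeal
    (hq : q.radical = IsLocalRing.maximalIdeal R) : q ≠ ⊤ := by
  rintro rfl
  rw [Ideal.radical_top] at hq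
  exact (IsLocalRing.maximalIdeal.isMaximal R).ne_top hq.symm

theorem IsGood.eq_zero_of_forall_mem [IsNoetherianRing R] [Module.Finite R M]
    (hq : q.radical = IsLocalRing.maximalIdeal R) {F : q.Filtration M} (hF : F.IsGood) {c : ℕ}
    {x : M} (hx : ∀ n ≥ c, x ∈ F.N n) : x = 0 := by
  obtain ⟨n₀, hn⟩ := hF.2.exists_pow_smul_eq
  have := Ideal.iInf_pow_smul_eq_bot_of_isLocalRing (M := M) q
    (Ideal.ne_top_of_radical_eq_maximalIdeal hq)
  rw [← Submodule.mem_bot R, ← this, Submodule.mem_iInf]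
  intro i
  have h1 := hx (n₀ + (c + i)) (by omega)
  rw [hn] at h1
  exact (Submodule.smul_mono (Ideal.pow_le_pow_right (by omega)) le_top) h1

theorem IsSuperficial.exists_torsionBy_inf_eq_bot [IsNoetherianRing R] [Module.Finite R M]
    (hq : q.radical = IsLocalRing.maximalIdeal R) {F : q.Filtration M} (hF : F.IsGood) {a : R}
    (ha : F.IsSuperficial a) : ∃ c, ∀ n ≥ c, Submodule.torsionBy R M a ⊓ F.N n = ⊥ := by
  obtain ⟨haq, c, hc⟩ := ha
  refine ⟨c, fun n hn => ?_⟩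
  rw [eq_bot_iff]
  rintro x ⟨hx, hxn⟩
  rw [Submodule.mem_bot]
  -- If `ax = 0` then `x` lies in every colon `M_{m+1} : a`, so superficiality puts it in every
  -- `M_m` with `m ≥ c`; Krull's intersection theorem concludes.
  refine hF.eq_zero_of_forall_mem hq (c := c) fun m hm => ?_
  rw [← hc m hm]
  refine ⟨?_, F.antitone hn hxn⟩
  change a • x ∈ F.N (m + 1)
  rw [(Submodule.mem_torsionBy_iff a x).mp hx]
  exact zero_mem _

theorem IsSuperficial.exists_pow_smul_eq_zero [IsNoetherianRing R] [Module.Finite R M]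
    (hq : q.radical = IsLocalRing.maximalIdeal R) {F : q.Filtration M} (hF : F.IsGood) {a : R}
    (ha : F.IsSuperficial a) : ∃ c, ∀ r ∈ q ^ c, ∀ x : M, a • x = 0 → r • x = 0 := by
  obtain ⟨c, hc⟩ := ha.exists_torsionBy_inf_eq_bot hq hF
  refine ⟨c, fun r hr x hx => ?_⟩
  rw [← Submodule.mem_bot R, ← hc c le_rfl]
  refine ⟨Submodule.smul_mem _ r ((Submodule.mem_torsionBy_iff a x).mpr hx),
    pow_smul_top_le hF.1 c (Submodule.smul_mem_smul hr Submodule.mem_top)⟩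

/-- A superficial element is regular on a module of positive depth. -/
theorem IsSuperficial.isSMulRegular [IsNoetherianRing R] [Module.Finite R M]
    (hq : q.radical = IsLocalRing.maximalIdeal R) {F : q.Filtration M} (hF : F.IsGood) {a : R}
    (ha : F.IsSuperficial a) {y : R} (hy : y ∈ IsLocalRing.maximalIdeal R)
    (hreg : IsSMulRegular M y) : IsSMulRegular M a := by
  obtain ⟨c, hc⟩ := ha.exists_pow_smul_eq_zero hq hF
  rw [← hq] at hy
  obtain ⟨k, hk⟩ := hy
  rw [isSMulRegular_iff_right_eq_zero_of_smul]
  intro x hx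
  have h1 : (y ^ k) ^ c • x = 0 := hc _ (Ideal.pow_mem_pow hk c) x hx
  exact (isSMulRegular_iff_right_eq_zero_of_smul.mp ((hreg.pow k).pow c)) x h1

theorem IsSuperficial.exists_succ_eq_smul [IsNoetherianRing R] [Module.Finite R M]
    (hq : q.radical = IsLocalRing.maximalIdeal R) {F : q.Filtration M} (hF : F.IsGood) {a : R}
    (ha : F.IsSuperficial a) (hfin : Module.length R (QuotSMulTop a M) ≠ ⊤) :
    ∃ n₀, ∀ n ≥ n₀, F.N (n + 1) = a • F.N n := by
  obtain ⟨n₀, h⟩ := ha.exists_mem_of_smul_mem hF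
  obtain ⟨k, hk⟩ : ∃ k, F.N k ≤ a • (⊤ : Submodule R M) := by
    have hfl := isFiniteLength_iff_isNoetherian_isArtinian.mp (Module.length_ne_top_iff.mp hfin)
    have := hfl.2
    -- The images of the `M_n` in the finite length module `M/aM` stabilize, and by Krull their
    -- stable value is 0.
    obtain ⟨m, hm⟩ := IsArtinian.monotone_stabilizes
      (⟨fun n => OrderDual.toDual ((F.quotient (a • (⊤ : Submodule R M))).N n),
        fun i j hij => (F.quotient (a • (⊤ : Submodule R M))).antitone hij⟩ :
        ℕ →o (Submodule R (QuotSMulTop a M))ᵒᵈ)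
    refine ⟨m, fun x hx => ?_⟩
    rw [← Submodule.Quotient.mk_eq_zero]
    refine (hF.quotient (a • (⊤ : Submodule R M))).eq_zero_of_forall_mem hq (c := m)
      fun n hn => ?_
    have h1 : (F.quotient (a • (⊤ : Submodule R M))).N m =
      (F.quotient (a • (⊤ : Submodule R M))).N n := hm n hn
    rw [← h1]
    exact Submodule.mem_map_of_mem hx
  refine ⟨n₀ + k, fun n hn => le_antisymm (fun x hx => ?_) ?_⟩
  · obtain ⟨y, _, rfl⟩ := (Submodule.mem_smul_pointwise_iff_exists _ _ _).mp
      (hk (F.antitone (show k ≤ n + 1 by omega) hx))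
    obtain ⟨z, hz, hzy⟩ := h n (by omega) y hx
    rw [← hzy]
    exact Submodule.smul_mem_pointwise_smul z a _ hz
  · rintro x hx
    obtain ⟨y, hy, rfl⟩ := (Submodule.mem_smul_pointwise_iff_exists _ _ _).mp hx
    exact F.smul_mem_succ ha.1 hy

end Local

/-! ### The Ratliff–Rush filtration. -/

section RatliffRush

variable {F : q.Filtration M} {a : R} (ha : a ∈ q) {n₀ : ℕ}
  (h : ∀ n ≥ n₀, (F.N (n + 1)).colonElem a = F.N n)

include h in
theorem mem_of_pow_smul_mem {n : ℕ} (hn : n₀ ≤ n) {x : M} (k : ℕ) (hx : a ^ k • x ∈ F.N (n + k)) :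
    x ∈ F.N n := by
  induction k with
  | zero => simpa using hx
  | succ k ih =>
    apply ih
    rw [← h (n + k) (by omega)]
    change a • a ^ k • x ∈ F.N (n + k + 1)
    rwa [smul_smul, ← pow_succ']

include ha h

theorem ratliffRush_eq {n : ℕ} (hn : n₀ ≤ n) : F.ratliffRush.N n = F.N n := by
  refine le_antisymm ?_ (F.le_ratliffRush n)
  rintro x ⟨k, _, hx⟩
  exact mem_of_pow_smul_mem h hn k (hx _ (Ideal.pow_mem_pow ha k))

/-- This is the gain over `F`: cancelling `a` works in all degrees, not only in large ones. -/
theorem ratliffRush_colonElem (n : ℕ) :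
    (F.ratliffRush.N (n + 1)).colonElem a = F.ratliffRush.N n := by
  refine le_antisymm ?_ (F.ratliffRush.le_colonElem ha n)
  rintro x ⟨k, hk, hx⟩
  -- The additional factor `q^n₀` raises the degree to at least `n₀`, where `a` cancels in `F`.
  have h1 : ∀ r ∈ q ^ (n₀ + k), r • x ∈ F.N (n + (n₀ + k)) := by
    intro r hr
    rw [← h _ (by omega)]
    change a • r • x ∈ F.N (n + (n₀ + k) + 1)
    rw [pow_add] at hr
    refine Submodule.mul_induction_on hr (fun s hs t ht => ?_) (fun s t hs ht => ?_)
    · rw [smul_comm, mul_smul, show n + (n₀ + k) + 1 = n₀ + (n + 1 + k) by omega]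
      exact F.pow_smul_le n₀ (n + 1 + k) (Submodule.smul_mem_smul hs (hx t ht))
    · rw [add_smul, smul_add]
      exact add_mem hs ht
  exact ⟨n₀ + k, by omega, h1⟩

end RatliffRush

end Ideal.Filtration

/-! ### Length formulas for colons, torsion and multiples. -/

section Length

variable {R M N : Type*} [CommRing R] [AddCommGroup M] [Module R M] [AddCommGroup N] [Module R N]

theorem Submodule.length_quotient_eq_relLength_add {L P : Submodule R M} (h : L ≤ P) :
    Module.length R (M ⧸ L) = P.relLength L + Module.length R (M ⧸ P) := by
  refine Module.length_eq_add_of_exact ((L.submoduleOf P).mapQ L P.subtype le_rfl)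
    (Submodule.factor h) ?_ (Submodule.factor_surjective h) ?_
  · refine (injective_iff_map_eq_zero _).mpr fun x hx => ?_
    obtain ⟨x, rfl⟩ := Submodule.Quotient.mk_surjective _ x
    have hx : (x : M) ∈ L := (Submodule.Quotient.mk_eq_zero L).mp hx
    exact (Submodule.Quotient.mk_eq_zero _).mpr hx
  · intro y
    obtain ⟨y, rfl⟩ := Submodule.Quotient.mk_surjective _ y
    constructor
    · intro hy
      have hy : y ∈ P := (Submodule.Quotient.mk_eq_zero P).mp hy
      exact ⟨Submodule.Quotient.mk ⟨y, hy⟩, rfl⟩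
    · rintro ⟨z, hz⟩
      obtain ⟨z, rfl⟩ := Submodule.Quotient.mk_surjective _ z
      rw [← hz]
      exact (Submodule.Quotient.mk_eq_zero P).mpr z.2

/-- Multiplication by `a` gives the exact sequence `0 → M/(L : a) → M/L → N/f(L) → 0`. -/
theorem Submodule.length_quotient_eq_colonElem_add {f : M →ₗ[R] N} (hf : Function.Surjective f)
    {a : R} (hker : LinearMap.ker f = a • (⊤ : Submodule R M)) (L : Submodule R M) :
    Module.length R (M ⧸ L) =
      Module.length R (M ⧸ L.colonElem a) + Module.length R (N ⧸ L.map f) := by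
  refine Module.length_eq_add_of_exact
    ((L.colonElem a).mapQ L (LinearMap.lsmul R M a) le_rfl)
    (L.mapQ (L.map f) f (Submodule.le_comap_map f L)) ?_ ?_ ?_
  · refine (injective_iff_map_eq_zero _).mpr fun x hx => ?_
    obtain ⟨x, rfl⟩ := Submodule.Quotient.mk_surjective _ x
    have hx : a • x ∈ L := (Submodule.Quotient.mk_eq_zero L).mp hx
    exact (Submodule.Quotient.mk_eq_zero _).mpr hx
  · intro y
    obtain ⟨y, rfl⟩ := Submodule.Quotient.mk_surjective _ y
    obtain ⟨x, rfl⟩ := hf y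
    exact ⟨Submodule.Quotient.mk x, rfl⟩
  · intro y
    obtain ⟨y, rfl⟩ := Submodule.Quotient.mk_surjective _ y
    constructor
    · intro hy
      obtain ⟨z, hz, hzy⟩ : f y ∈ L.map f := (Submodule.Quotient.mk_eq_zero _).mp hy
      obtain ⟨w, hw⟩ : ∃ w, a • w = y - z :=
        (LinearMap.mem_range_smul_of_ker_eq hker).mp (by rw [map_sub, hzy, sub_self])
      refine ⟨Submodule.Quotient.mk w, ?_⟩
      change Submodule.Quotient.mk (a • w) = _
      rw [Submodule.Quotient.eq, hw]
      simpa using hz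
    · rintro ⟨z, hz⟩
      obtain ⟨z, rfl⟩ := Submodule.Quotient.mk_surjective _ z
      rw [← hz]
      change Submodule.Quotient.mk (f (a • z)) = (0 : N ⧸ L.map f)
      rw [(LinearMap.mem_range_smul_of_ker_eq hker).mpr ⟨z, rfl⟩]
      rfl

theorem Submodule.length_quotient_eq_add_of_inf_eq_bot {K L : Submodule R M} (h : K ⊓ L = ⊥) :
    Module.length R (M ⧸ L) = Module.length R K + Module.length R (M ⧸ K ⊔ L) := by
  refine Module.length_eq_add_of_exact (L.mkQ ∘ₗ K.subtype)
    (Submodule.factor (le_sup_right : L ≤ K ⊔ L)) ?_ (Submodule.factor_surjective _) ?_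
  · rw [← LinearMap.ker_eq_bot, ← le_bot_iff]
    rintro ⟨x, hx⟩ hx'
    have hx' : x ∈ L := (Submodule.Quotient.mk_eq_zero L).mp hx'
    have : x ∈ K ⊓ L := ⟨hx, hx'⟩
    rw [h] at this
    simpa using this
  · intro y
    obtain ⟨y, rfl⟩ := Submodule.Quotient.mk_surjective _ y
    constructor
    · intro hy
      obtain ⟨k, hk, l, hl, rfl⟩ :=
        Submodule.mem_sup.mp ((Submodule.Quotient.mk_eq_zero _).mp hy : y ∈ K ⊔ L)
      refine ⟨⟨k, hk⟩, ?_⟩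
      change Submodule.Quotient.mk k = Submodule.Quotient.mk (k + l)
      rw [Submodule.Quotient.eq]
      simpa using hl
    · rintro ⟨z, hz⟩
      rw [← hz]
      exact (Submodule.Quotient.mk_eq_zero (K ⊔ L)).mpr (Submodule.mem_sup_left z.2)

theorem Submodule.colonElem_smul (a : R) (L : Submodule R M) :
    (a • L).colonElem a = Submodule.torsionBy R M a ⊔ L := by
  ext x
  rw [Submodule.mem_sup]
  constructor
  · intro hx
    obtain ⟨y, hy, hyx⟩ := (Submodule.mem_smul_pointwise_iff_exists _ _ _).mp hx
    refine ⟨x - y, ?_, y, hy, by simp⟩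
    rw [Submodule.mem_torsionBy_iff, smul_sub, hyx]
    simp
  · rintro ⟨k, hk, l, hl, rfl⟩
    change a • (k + l) ∈ a • L
    rw [smul_add, (Submodule.mem_torsionBy_iff a k).mp hk, zero_add]
    exact Submodule.smul_mem_pointwise_smul l a L hl

theorem Submodule.length_quotient_smul (a : R) (L : Submodule R M) :
    Module.length R (M ⧸ a • L) =
      Module.length R (M ⧸ Submodule.torsionBy R M a ⊔ L) +
        Module.length R (QuotSMulTop a M) := by
  have h1 := Submodule.length_quotient_eq_colonElem_add (f := (a • (⊤ : Submodule R M)).mkQ)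
    (Submodule.mkQ_surjective _) (Submodule.ker_mkQ _) (a • L)
  have h2 : (a • L).map (a • (⊤ : Submodule R M)).mkQ = ⊥ := by
    rw [← le_bot_iff, Submodule.map_le_iff_le_comap, Submodule.comap_bot, Submodule.ker_mkQ]
    exact Submodule.map_mono le_top
  rw [Submodule.colonElem_smul] at h1
  rw [h1, (Submodule.quotEquivOfEqBot _ h2).length_eq]

theorem Submodule.relLength_colonElem_eq (L : Submodule R M) (a : R) :
    (L.colonElem a).relLength L = Module.length R (Submodule.torsionBy R (M ⧸ L) a) := by
  have hmem : ∀ x : L.colonElem a, L.mkQ x ∈ Submodule.torsionBy R (M ⧸ L) a := fun x => by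
    rw [Submodule.mem_torsionBy_iff, ← map_smul, Submodule.mkQ_apply,
      Submodule.Quotient.mk_eq_zero]
    exact x.2
  let f : L.colonElem a →ₗ[R] Submodule.torsionBy R (M ⧸ L) a :=
    (L.mkQ ∘ₗ (L.colonElem a).subtype).codRestrict _ hmem
  have hf : Function.Surjective f := by
    rintro ⟨y, hy⟩
    obtain ⟨y, rfl⟩ := Submodule.Quotient.mk_surjective _ y
    rw [Submodule.mem_torsionBy_iff, ← Submodule.Quotient.mk_smul,
      Submodule.Quotient.mk_eq_zero] at hy
    exact ⟨⟨y, hy⟩, rfl⟩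
  have hker : LinearMap.ker f = L.submoduleOf (L.colonElem a) := by
    ext x
    rw [LinearMap.mem_ker, ← Subtype.coe_inj]
    exact Submodule.Quotient.mk_eq_zero L
  exact ((Submodule.quotEquivOfEq _ _ hker.symm).trans
    (f.quotKerEquivOfSurjective hf)).length_eq

end Length

/-! ### Hilbert functions modulo one element. -/

namespace Ideal.Filtration

variable {R M N : Type*} [CommRing R] [AddCommGroup M] [Module R M] [AddCommGroup N] [Module R N]
  {q : Ideal R}

/-- The function `n ↦ λ(M / M_n)`. -/
noncomputable def colength (F : q.Filtration M) (n : ℕ) : ℕ :=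
  (Module.length R (M ⧸ F.N n)).toNat

theorem colength_zero {F : q.Filtration M} (h0 : F.N 0 = ⊤) : F.colength 0 = 0 := by
  have : Subsingleton (M ⧸ F.N 0) := Submodule.Quotient.subsingleton_iff.mpr h0
  rw [colength, Module.length_eq_zero]
  rfl

theorem colength_succ {F : q.Filtration M} (hfin : ∀ n, Module.length R (M ⧸ F.N n) ≠ ⊤) (n : ℕ) :
    F.colength (n + 1) = F.hilbertFun n + F.colength n := by
  have h1 := Submodule.length_quotient_eq_relLength_add (F.mono n)
  have h2 : (F.N n).relLength (F.N (n + 1)) ≠ ⊤ := by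
    intro h
    rw [h, top_add] at h1
    exact hfin _ h1
  rw [colength, h1, ENat.toNat_add h2 (hfin n)]
  rfl

theorem le_succ_of_hilbertFun_eq_zero {F : q.Filtration M}
    (hfin : ∀ n, Module.length R (M ⧸ F.N n) ≠ ⊤) {n : ℕ} (h : F.hilbertFun n = 0) :
    F.N n ≤ F.N (n + 1) := by
  have h1 := Submodule.length_quotient_eq_relLength_add (F.mono n)
  have h2 : (F.N n).relLength (F.N (n + 1)) ≠ ⊤ := by
    intro h
    rw [h, top_add] at h1
    exact hfin _ h1
  have h3 : (F.N n).relLength (F.N (n + 1)) = 0 := by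
    rw [hilbertFun, ENat.toNat_eq_zero] at h
    exact h.resolve_right h2
  have h4 := Module.length_eq_zero_iff.mp h3
  rw [Submodule.Quotient.subsingleton_iff] at h4
  exact fun x hx => (h4 ▸ Submodule.mem_top : (⟨x, hx⟩ : F.N n) ∈ (F.N (n + 1)).submoduleOf (F.N n))

theorem colength_eq_sum {F : q.Filtration M} (h0 : F.N 0 = ⊤)
    (hfin : ∀ n, Module.length R (M ⧸ F.N n) ≠ ⊤) (n : ℕ) :
    F.colength n = ∑ i ∈ Finset.range n, F.hilbertFun i := by
  induction n with
  | zero => rw [colength_zero h0, Finset.sum_range_zero]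
  | succ n ih => rw [colength_succ hfin, Finset.sum_range_succ, ih, add_comm]

/-- The Hilbert functions of a filtration and of its image modulo `a`. -/
theorem exists_hilbertFun_add_eq_sum {F : q.Filtration M} {G : q.Filtration N} {a : R}
    {f : M →ₗ[R] N} (hf : Function.Surjective f)
    (hker : LinearMap.ker f = a • (⊤ : Submodule R M)) (hG : ∀ n, G.N n = (F.N n).map f)
    (ha : a ∈ q) (h0 : F.N 0 = ⊤) (hfin : ∀ n, Module.length R (M ⧸ F.N n) ≠ ⊤)
    (hGfin : ∀ n, Module.length R (N ⧸ G.N n) ≠ ⊤) :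
    ∃ w : ℕ → ℕ,
      (∀ n, F.hilbertFun n + w n = ∑ i ∈ Finset.range (n + 1), G.hilbertFun i) ∧
      ∀ n, (F.N (n + 1)).colonElem a = F.N n → w n = 0 := by
  have hG0 : G.N 0 = ⊤ := by
    rw [hG, h0, Submodule.map_top, LinearMap.range_eq_top.mpr hf]
  -- The correction term is `w n = λ((M_{n+1} : a) / M_n)`.
  refine ⟨fun n => (((F.N (n + 1)).colonElem a).relLength (F.N n)).toNat, fun n => ?_,
    fun n hn => ?_⟩
  · have h1 := Submodule.length_quotient_eq_colonElem_add hf hker (F.N (n + 1))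
    rw [← hG] at h1
    have h2 := Submodule.length_quotient_eq_relLength_add (F.le_colonElem ha n)
    have h3 : Module.length R (M ⧸ (F.N (n + 1)).colonElem a) ≠ ⊤ := by
      intro h
      rw [h, top_add] at h1
      exact hfin _ h1
    have h4 : ((F.N (n + 1)).colonElem a).relLength (F.N n) ≠ ⊤ := by
      intro h
      rw [h, top_add] at h2
      exact hfin _ h2
    have h1' := congrArg ENat.toNat h1
    have h2' := congrArg ENat.toNat h2
    rw [ENat.toNat_add h3 (hGfin _)] at h1'
    rw [ENat.toNat_add h4 h3] at h2'
    change F.colength (n + 1) = _ + G.colength (n + 1) at h1'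
    change F.colength n = _ at h2'
    have h5 := colength_succ hfin n
    rw [← colength_eq_sum hG0 hGfin]
    dsimp only
    omega
  · have : Subsingleton (((F.N (n + 1)).colonElem a) ⧸
        (F.N n).submoduleOf ((F.N (n + 1)).colonElem a)) := by
      rw [Submodule.Quotient.subsingleton_iff, hn]
      exact Submodule.submoduleOf_self _
    dsimp only
    rw [Submodule.relLength, Module.length_eq_zero]
    rfl

/-- The Hilbert function of a filtration is bounded by `λ(M / aM)`, and it is eventually
`λ(M / aM) - λ(0 :_M a)` if `M_{n+1} = a M_n` for large `n`. -/
theorem hilbertFun_add_length_torsionBy {F : q.Filtration M} {a : R} (ha : a ∈ q)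
    (hfin : ∀ n, Module.length R (M ⧸ F.N n) ≠ ⊤)
    (hafin : Module.length R (QuotSMulTop a M) ≠ ⊤) :
    (∀ n, F.hilbertFun n ≤ (Module.length R (QuotSMulTop a M)).toNat) ∧
    ∀ n, F.N (n + 1) = a • F.N n → Submodule.torsionBy R M a ⊓ F.N n = ⊥ →
      F.hilbertFun n + (Module.length R (Submodule.torsionBy R M a)).toNat =
        (Module.length R (QuotSMulTop a M)).toNat := by
  have hle : ∀ n, a • F.N n ≤ F.N (n + 1) := by
    rintro n x hx
    obtain ⟨y, hy, rfl⟩ := (Submodule.mem_smul_pointwise_iff_exists _ _ _).mp hx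
    exact F.smul_mem_succ ha hy
  have hmono : ∀ {P Q : Submodule R M}, P ≤ Q →
      Module.length R (M ⧸ Q) ≤ Module.length R (M ⧸ P) := fun h =>
    Module.length_le_of_surjective (Submodule.factor h) (Submodule.factor_surjective h)
  have hsup : ∀ n, Module.length R (M ⧸ Submodule.torsionBy R M a ⊔ F.N n) ≠ ⊤ := fun n h =>
    hfin n (top_le_iff.mp (h ▸ hmono le_sup_right))
  refine ⟨fun n => ?_, fun n h1 h2 => ?_⟩
  -- Here `aM_n ⊆ M_{n+1}` bounds `λ(M/M_{n+1})` by `λ(M/aM_n)`. In the second half this inclusion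
  -- is an equality, and the torsion, meeting `M_n` trivially, accounts for the whole defect.
  · have h1 : Module.length R (M ⧸ F.N (n + 1)) ≤
        Module.length R (M ⧸ F.N n) + Module.length R (QuotSMulTop a M) := by
      refine (hmono (hle n)).trans ?_
      rw [Submodule.length_quotient_smul]
      gcongr
      exact hmono le_sup_right
    have h2 := ENat.toNat_le_toNat h1 (by simp [hfin n, hafin])
    rw [ENat.toNat_add (hfin n) hafin] at h2
    change F.colength (n + 1) ≤ F.colength n + _ at h2
    have h3 := colength_succ hfin n
    omega
  · have h3 := Submodule.length_quotient_smul a (F.N n)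
    rw [← h1] at h3
    have h3 := congrArg ENat.toNat h3
    rw [ENat.toNat_add (hsup n) hafin] at h3
    have h4 := Submodule.length_quotient_eq_add_of_inf_eq_bot h2
    have h5 : Module.length R (Submodule.torsionBy R M a) ≠ ⊤ := by
      intro h
      rw [h, top_add] at h4
      exact hfin _ h4
    have h4 := congrArg ENat.toNat h4
    rw [ENat.toNat_add h5 (hsup n)] at h4
    change F.colength (n + 1) = _ at h3
    change F.colength n = _ at h4
    have h6 := colength_succ hfin n
    omega

theorem length_torsionBy_ne_top {F : q.Filtration M} {a : R} {n : ℕ}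
    (hfin : Module.length R (M ⧸ F.N n) ≠ ⊤) (h : Submodule.torsionBy R M a ⊓ F.N n = ⊥) :
    Module.length R (Submodule.torsionBy R M a) ≠ ⊤ := by
  have h4 := Submodule.length_quotient_eq_add_of_inf_eq_bot h
  intro h'
  rw [h', top_add] at h4
  exact hfin h4

theorem hilbertFun_eq_of_equiv {F : q.Filtration M} {G : q.Filtration N} (e : M ≃ₗ[R] N)
    (hG : ∀ n, G.N n = (F.N n).map (e : M →ₗ[R] N))
    (hfin : ∀ n, Module.length R (M ⧸ F.N n) ≠ ⊤) (n : ℕ) : G.hilbertFun n = F.hilbertFun n := by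
  have h1 : ∀ n, Module.length R (M ⧸ F.N n) = Module.length R (N ⧸ G.N n) := fun n =>
    (Submodule.Quotient.equiv _ _ e (hG n).symm).length_eq
  have h2 := colength_succ hfin n
  have h3 := colength_succ (F := G) (fun n => h1 n ▸ hfin n) n
  have h4 : ∀ n, F.colength n = G.colength n := fun n => congrArg ENat.toNat (h1 n)
  rw [h4, h4] at h2
  omega

end Ideal.Filtration

/-! ### Power series and expansion at 1. -/

section Series

theorem PowerSeries.one_sub_X_mul_mk_sum (h : ℕ → ℤ) :
    (1 - PowerSeries.X) * PowerSeries.mk (fun n => ∑ i ∈ Finset.range (n + 1), h i) =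
      PowerSeries.mk h := by
  ext n
  rw [sub_mul, one_mul, map_sub, PowerSeries.coeff_mk, PowerSeries.coeff_mk]
  cases n with
  | zero => simp
  | succ n =>
    rw [PowerSeries.coeff_succ_X_mul, PowerSeries.coeff_mk, Finset.sum_range_succ _ (n + 1)]
    ring

theorem Polynomial.exists_coe_eq_mk {u : ℕ → ℤ} {n₀ : ℕ} (h : ∀ n ≥ n₀, u n = 0) :
    ∃ W : Polynomial ℤ, (W : PowerSeries ℤ) = PowerSeries.mk u := by
  refine ⟨PowerSeries.trunc n₀ (PowerSeries.mk u), ?_⟩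
  ext n
  rw [Polynomial.coeff_coe, PowerSeries.coeff_trunc, PowerSeries.coeff_mk]
  split_ifs with hn
  · rfl
  · exact (h n (by omega)).symm

/-- The Taylor shift to 1 turns `1 - X` into `-X`, so the product has order at least `r` there. -/
theorem Polynomial.eval_one_hasseDeriv_one_sub_X_pow_mul {i r : ℕ} (hi : i < r)
    (W : Polynomial ℤ) :
    (Polynomial.hasseDeriv i ((1 - Polynomial.X) ^ r * W)).eval 1 = 0 := by
  rw [← Polynomial.taylor_coeff, Polynomial.taylor_mul, Polynomial.taylor_pow]
  have : Polynomial.taylor 1 (1 - Polynomial.X : Polynomial ℤ) = Polynomial.X * (-1) := by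
    simp
  rw [this, mul_pow, mul_assoc, Polynomial.coeff_X_pow_mul', if_neg (by omega)]

end Series

/-! ### Comparison of Hilbert coefficients. -/

namespace Ideal.Filtration

variable {R M N : Type*} [CommRing R] [AddCommGroup M] [Module R M] [AddCommGroup N] [Module R N]
  {q : Ideal R}

/-- `p` is the numerator of the Hilbert series. -/
def IsHPoly (F : q.Filtration M) (p : Polynomial ℤ) : Prop :=
  (p : PowerSeries ℤ) = (1 - PowerSeries.X) ^ Module.natDim R M * F.hilbertSeries

theorem IsHPoly.hPoly_eq {F : q.Filtration M} {p : Polynomial ℤ} (hp : F.IsHPoly p) :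
    F.hPoly = p := by
  have h : ∃ p : Polynomial ℤ, (p : PowerSeries ℤ) =
    (1 - PowerSeries.X) ^ Module.natDim R M * F.hilbertSeries := ⟨p, hp⟩
  rw [hPoly, dif_pos h]
  exact Polynomial.coe_injective ℤ (h.choose_spec.trans hp.symm)

theorem IsHPoly.hilbertCoeff_eq {F : q.Filtration M} {G : q.Filtration N} {p p' W : Polynomial ℤ}
    (hp : F.IsHPoly p) (hp' : G.IsHPoly p') {r : ℕ}
    (h : p = p' + (1 - Polynomial.X) ^ (r + 1) * W) {i : ℕ} (hi : i ≤ r) :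
    F.hilbertCoeff i = G.hilbertCoeff i := by
  rw [hilbertCoeff, hilbertCoeff, hp.hPoly_eq, hp'.hPoly_eq, h, map_add, Polynomial.eval_add,
    Polynomial.eval_one_hasseDeriv_one_sub_X_pow_mul (by omega), add_zero]

/-- The corrections `w` form a polynomial `W` with `(1 - t)(P_F + W) = P_G`, so the numerators
differ by a multiple of `(1 - t)^(r+1)`. -/
theorem IsHPoly.exists_of_sum {F : q.Filtration M} {G : q.Filtration N} {p : Polynomial ℤ}
    (hp : G.IsHPoly p) {r : ℕ} (hM : Module.natDim R M = r + 1) (hN : Module.natDim R N = r)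
    {w : ℕ → ℕ} (hw : ∀ n, F.hilbertFun n + w n = ∑ i ∈ Finset.range (n + 1), G.hilbertFun i)
    {n₀ : ℕ} (hw0 : ∀ n ≥ n₀, w n = 0) :
    (∃ p, F.IsHPoly p) ∧ ∀ i ≤ r, F.hilbertCoeff i = G.hilbertCoeff i := by
  obtain ⟨W, hW⟩ := Polynomial.exists_coe_eq_mk (u := fun n => (w n : ℤ)) (n₀ := n₀)
    (fun n hn => by simp [hw0 n hn])
  have h1 : (1 - PowerSeries.X) * (F.hilbertSeries + (W : PowerSeries ℤ)) = G.hilbertSeries := by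
    have h2 := PowerSeries.one_sub_X_mul_mk_sum (fun n => (G.hilbertFun n : ℤ))
    rw [hilbertSeries, hilbertSeries, hW, ← h2]
    congr 1
    ext n
    rw [map_add, PowerSeries.coeff_mk, PowerSeries.coeff_mk, PowerSeries.coeff_mk]
    exact_mod_cast hw n
  have h3 : F.IsHPoly (p + (1 - Polynomial.X) ^ (r + 1) * (-W)) := by
    rw [IsHPoly, hM]
    rw [IsHPoly, hN, ← h1] at hp
    push_cast
    rw [hp]
    ring
  exact ⟨⟨_, h3⟩, fun i hi => h3.hilbertCoeff_eq hp rfl hi⟩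

/-- Comparing colengths rather than Hilbert functions gains a factor `1 - t`: the numerators agree
modulo `(1 - t)^(dim M + 1)`. Thus even the coefficient of index `dim M` is preserved, as needed for
`e_2` in dimension 2. -/
theorem IsHPoly.exists_of_eventually_eq {F G : q.Filtration M} {p : Polynomial ℤ}
    (hp : G.IsHPoly p) (hF0 : F.N 0 = ⊤) (hG0 : G.N 0 = ⊤)
    (hF : ∀ n, Module.length R (M ⧸ F.N n) ≠ ⊤) (hG : ∀ n, Module.length R (M ⧸ G.N n) ≠ ⊤)
    {n₀ : ℕ} (h : ∀ n ≥ n₀, F.N n = G.N n) :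
    (∃ p, F.IsHPoly p) ∧ ∀ i ≤ Module.natDim R M, F.hilbertCoeff i = G.hilbertCoeff i := by
  obtain ⟨W, hW⟩ := Polynomial.exists_coe_eq_mk
    (u := fun n => ((F.colength (n + 1) : ℤ) - G.colength (n + 1))) (n₀ := n₀)
    (fun n hn => by rw [colength, colength, h (n + 1) (by omega), sub_self])
  have h1 : F.hilbertSeries = G.hilbertSeries + (1 - PowerSeries.X) * (W : PowerSeries ℤ) := by
    have h2 := PowerSeries.one_sub_X_mul_mk_sum (fun n => (G.hilbertFun n : ℤ))
    have h3 := PowerSeries.one_sub_X_mul_mk_sum (fun n => (F.hilbertFun n : ℤ))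
    rw [hilbertSeries, hilbertSeries, hW, ← h2, ← h3, ← mul_add]
    congr 1
    ext n
    rw [map_add, PowerSeries.coeff_mk, PowerSeries.coeff_mk, PowerSeries.coeff_mk,
      colength_eq_sum hF0 hF, colength_eq_sum hG0 hG]
    push_cast
    ring
  have h3 : F.IsHPoly (p + (1 - Polynomial.X) ^ (Module.natDim R M + 1) * W) := by
    rw [IsHPoly, h1]
    rw [IsHPoly] at hp
    push_cast
    rw [hp]
    ring
  exact ⟨⟨_, h3⟩, fun i hi => h3.hilbertCoeff_eq hp rfl hi⟩

/-! ### The numerical estimate in dimension two. -/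

section DimTwo

variable {F : q.Filtration M} (hM : Module.natDim R M = 2) {h : ℕ → ℕ} {e J : ℕ}
  (hsum : ∀ n, F.hilbertFun n = ∑ i ∈ Finset.range (n + 1), h i) (hJ : ∀ n ≥ J, h n = e)

include hM hsum

theorem isHPoly_of_dim_two {g : Polynomial ℤ}
    (hg : (g : PowerSeries ℤ) = PowerSeries.mk fun n => (e : ℤ) - h n) :
    F.IsHPoly (Polynomial.C (e : ℤ) - (1 - Polynomial.X) * g) := by
  have h2 := PowerSeries.one_sub_X_mul_mk_sum (fun n => (h n : ℤ))
  have h3 : F.hilbertSeries = PowerSeries.mk fun n => ∑ i ∈ Finset.range (n + 1), (h i : ℤ) := by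
    rw [hilbertSeries]
    congr 1
    ext n
    exact_mod_cast hsum n
  have h4 : (PowerSeries.mk fun n => (h n : ℤ)) =
      PowerSeries.C (e : ℤ) * PowerSeries.mk 1 - (g : PowerSeries ℤ) := by
    rw [hg]
    ext n
    rw [map_sub, PowerSeries.coeff_C_mul]
    simp
  have h5 := PowerSeries.mk_one_mul_one_sub_eq_one ℤ
  rw [IsHPoly, hM, pow_two, mul_assoc, h3, h2, h4, mul_sub, ← mul_assoc, mul_comm _ (PowerSeries.C _),
    mul_assoc, mul_comm _ (PowerSeries.mk 1), h5]
  push_cast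
  simp

include hJ

/-- With `g = ∑ (e - h_j) X^j` the numerator is `e - (1 - X) g`, whose expansion at 1 gives `e_1 =
g(1)` and `e_2 = g'(1)`. -/
theorem hilbertCoeff_of_dim_two :
    F.hilbertCoeff 0 = e ∧ F.hilbertCoeff 1 = ∑ j ∈ Finset.range J, ((e : ℤ) - h j) ∧
      F.hilbertCoeff 2 = ∑ j ∈ Finset.range J, (j : ℤ) * ((e : ℤ) - h j) := by
  have hg : ((∑ j ∈ Finset.range J, Polynomial.monomial j ((e : ℤ) - h j) : Polynomial ℤ) :
      PowerSeries ℤ) = PowerSeries.mk fun n => (e : ℤ) - h n := by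
    ext n
    rw [Polynomial.coeff_coe, Polynomial.finsetSum_coeff, PowerSeries.coeff_mk]
    simp only [Polynomial.coeff_monomial, Finset.sum_ite_eq', Finset.mem_range]
    split_ifs with hn
    · rfl
    · rw [hJ n (by omega), sub_self]
  have hp := (isHPoly_of_dim_two hM hsum hg).hPoly_eq
  set g : Polynomial ℤ := ∑ j ∈ Finset.range J, Polynomial.monomial j ((e : ℤ) - h j) with hgdef
  have ht : Polynomial.taylor 1 F.hPoly =
      Polynomial.C (e : ℤ) + Polynomial.X * Polynomial.taylor 1 g := by
    rw [hp, map_sub, Polynomial.taylor_mul, Polynomial.taylor_C]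
    simp
  simp only [hilbertCoeff, ← Polynomial.taylor_coeff, ht]
  refine ⟨by simp, ?_, ?_⟩
  · rw [Polynomial.coeff_add, Polynomial.coeff_X_mul, Polynomial.taylor_coeff_zero, hgdef]
    simp [Polynomial.eval_finsetSum]
  · rw [Polynomial.coeff_add, Polynomial.coeff_X_mul, Polynomial.taylor_coeff_one, hgdef]
    rw [show (Polynomial.C (e : ℤ)).coeff (1 + 1) = 0 from Polynomial.coeff_C_succ, zero_add,
      Polynomial.derivative_sum, Polynomial.eval_finsetSum]
    refine Finset.sum_congr rfl fun j _ => ?_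
    rw [Polynomial.derivative_monomial, Polynomial.eval_monomial, one_pow, mul_one, mul_comm]

theorem hilbertPolynomial_eval_of_dim_two (x : ℚ) :
    F.hilbertPolynomial.eval x =
      e * (x + 1) - ((∑ j ∈ Finset.range J, ((e : ℤ) - h j) : ℤ) : ℚ) := by
  obtain ⟨h0, h1, -⟩ := hilbertCoeff_of_dim_two hM hsum hJ
  rw [hilbertPolynomial, hM, Finset.sum_range_succ, Finset.sum_range_one, h0, h1]
  generalize (∑ j ∈ Finset.range J, ((e : ℤ) - h j)) = e₁
  simp [Polynomial.preHilbertPoly]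
  ring

theorem hilbertFunInt_sub_hilbertPolynomial_eval (m : ℕ) :
    (F.hilbertFunInt (m - 1) : ℚ) - F.hilbertPolynomial.eval (((m - 1 : ℤ)) : ℚ) =
      ((∑ j ∈ Finset.range J, ((e : ℤ) - h j) - ∑ j ∈ Finset.range m, ((e : ℤ) - h j) : ℤ) : ℚ) := by
  rw [hilbertPolynomial_eval_of_dim_two hM hsum hJ]
  have : F.hilbertFunInt (m - 1) = ∑ j ∈ Finset.range m, h j := by
    cases m with
    | zero => simp [hilbertFunInt]
    | succ m =>
      rw [← hsum, hilbertFunInt]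
      simp
  rw [this]
  push_cast
  simp only [Finset.sum_sub_distrib, Finset.sum_const, Finset.card_range, nsmul_eq_mul]
  ring

theorem exists_isPostulationNumber_of_dim_two (he : 0 < e) {l : ℕ} (hl : ∀ n, h n ≤ e + l) :
    ∃ s : ℤ, F.IsPostulationNumber s ∧
      F.hilbertCoeff 2 ≥ -(Ring.choose (s + 2) 2 * (l : ℤ)) := by
  have key := hilbertFunInt_sub_hilbertPolynomial_eval hM hsum hJ
  obtain ⟨-, -, he2⟩ := hilbertCoeff_of_dim_two hM hsum hJ
  have htail : ∀ (u : ℕ → ℤ) (a b : ℕ), (∀ n ≥ a, u n = 0) → a ≤ b →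
      ∑ j ∈ Finset.range b, u j = ∑ j ∈ Finset.range a, u j := by
    intro u a b hu hab
    refine (Finset.sum_subset (Finset.range_subset_range.mpr hab) fun j _ hj => hu j ?_).symm
    simpa using hj
  -- The Hilbert polynomial is linear of slope `e > 0`, so it cannot vanish at both -1 and -2, where
  -- the Hilbert function is 0. Hence `s ≥ -2` and `m = s + 2` is a natural number.
  have hlow : ∃ z : ℤ, -2 ≤ z ∧ (F.hilbertFunInt z : ℚ) ≠ F.hilbertPolynomial.eval (z : ℚ) := by
    by_contra! hcon
    have h1 := hcon (-1) (by norm_num)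
    have h2 := hcon (-2) (by norm_num)
    rw [hilbertPolynomial_eval_of_dim_two hM hsum hJ, hilbertFunInt, if_neg (by norm_num)] at h1 h2
    push_cast at h1 h2
    have h3 : (e : ℚ) = 0 := by linarith
    exact he.ne' (by exact_mod_cast h3)
  obtain ⟨z, hz, hzP⟩ := hlow
  obtain ⟨s, hs, hmax⟩ := Int.exists_greatest_of_bdd
    (P := fun n : ℤ => (F.hilbertFunInt n : ℚ) ≠ F.hilbertPolynomial.eval (n : ℚ))
    ⟨J, fun n hn => by
      by_contra! hcon
      obtain ⟨m, rfl⟩ : ∃ m : ℕ, n = m - 1 := ⟨(n + 1).toNat, by omega⟩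
      apply hn
      rw [← sub_eq_zero, key m, htail _ J m (fun n hn => by simp [hJ n hn]) (by omega)]
      simp⟩ ⟨z, hzP⟩
  refine ⟨s, ⟨hs, hmax⟩, ?_⟩
  obtain ⟨m, hm⟩ : ∃ m : ℕ, s = m - 2 := ⟨(s + 2).toNat, by have := hmax z hzP; omega⟩
  have hT : ∀ k ≥ m, ∑ j ∈ Finset.range J, ((e : ℤ) - h j) =
      ∑ j ∈ Finset.range k, ((e : ℤ) - h j) := by
    intro k hk
    by_contra hne
    have h1 := hmax (k - 1) (by
      rw [ne_eq, ← sub_eq_zero, key k]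
      exact_mod_cast sub_ne_zero.mpr hne)
    omega
  -- The partial sums are constant from `m` on, so each later term vanishes.
  have hδ : ∀ k ≥ m, (e : ℤ) - h k = 0 := by
    intro k hk
    have h1 := hT k hk
    rw [hT (k + 1) (by omega), Finset.sum_range_succ] at h1
    linarith
  have h3 : F.hilbertCoeff 2 = ∑ j ∈ Finset.range m, (j : ℤ) * ((e : ℤ) - h j) := by
    rw [he2, ← htail _ J (max J m) (fun n hn => by simp [hJ n hn]) (le_max_left _ _),
      ← htail _ m (max J m) (fun n hn => by simp [hδ n hn]) (le_max_right _ _)]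
  have h4 : s + 2 = (m : ℤ) := by omega
  -- Writing `binom(m, 2)` as `∑_{j < m} j` allows a termwise comparison using `e - h_j ≥ -l`.
  rw [h4, Ring.choose_natCast, h3, Nat.choose_two_right, ← Finset.sum_range_id, Nat.cast_sum,
    Finset.sum_mul, ← Finset.sum_neg_distrib]
  refine Finset.sum_le_sum fun j _ => ?_
  rw [← mul_neg]
  have h5 : (h j : ℤ) ≤ e + l := by exact_mod_cast hl j
  exact mul_le_mul_of_nonneg_left (by linarith) (Nat.cast_nonneg j)

end DimTwo

end Ideal.Filtration

/-! ### Superficial elements in dimensions one and two; descent of coefficients. -/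

namespace Ideal.Filtration

variable {R M N : Type*} [CommRing R] [IsLocalRing R] [IsNoetherianRing R] [AddCommGroup M]
  [Module R M] [Module.Finite R M] [AddCommGroup N] [Module R N] [Module.Finite R N] {q : Ideal R}
  (hq : q.radical = IsLocalRing.maximalIdeal R)

include hq

/-- It suffices that `a` avoids the minimal primes of the annihilator. Such a prime is `ann(x)` for
some `x`; if it contains `a`, then `ax = 0`, a power of `q` kills `x`, and the prime is maximal.
Being also minimal, it is the whole support, contradicting dimension 1. -/
theorem IsSuperficial.length_quotSMulTop_ne_top {F : q.Filtration M} (hF : F.IsGood) {a : R}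
    (ha : F.IsSuperficial a) (hdim : Module.supportDim R M = 1) :
    Module.length R (QuotSMulTop a M) ≠ ⊤ := by
  refine Module.length_ne_top_of_supportDim_le_zero ?_
  have h1 := Module.supportDim_quotSMulTop_succ_le_of_notMem_minimalPrimes (M := M) (x := a) ?_
  · rw [hdim] at h1
    rw [← ENat.WithBot.add_le_add_one_right_iff]
    simpa using h1
  · intro p hp hap
    obtain ⟨c, hc⟩ := ha.exists_pow_smul_eq_zero hq hF
    have hpa : IsAssociatedPrime p M := 
      Module.associatedPrimes.minimalPrimes_annihilator_subset_associatedPrimes R M hp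
    obtain ⟨hprime, x, hx⟩ := isAssociatedPrime_iff.mp hpa
    have hax : a • x = 0 := by
      rw [hx, Submodule.mem_colon_singleton] at hap
      simpa using hap
    have h2 : q ^ c ≤ p := fun r hr => by
      rw [hx, Submodule.mem_colon_singleton]
      simpa using hc r hr x hax
    have h3 : IsLocalRing.maximalIdeal R ≤ p := by
      rw [← hq, hprime.radical_le_iff]
      exact Ideal.IsPrime.le_of_pow_le h2
    have key : ∀ p' ∈ Module.support R M, p'.asIdeal = IsLocalRing.maximalIdeal R := fun p' hp' =>
      le_antisymm (IsLocalRing.le_maximalIdeal p'.2.ne_top) (h3.trans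
        (hp.2 ⟨p'.2, Module.annihilator_le_of_mem_support hp'⟩
          ((IsLocalRing.le_maximalIdeal p'.2.ne_top).trans h3)))
    have : Subsingleton (Module.support R M) :=
      ⟨fun x y => Subtype.ext (PrimeSpectrum.ext ((key x x.2).trans (key y y.2).symm))⟩
    have h4 : Module.supportDim R M ≤ 0 := Order.krullDim_nonpos_of_subsingleton
    rw [hdim] at h4
    exact absurd h4 (by decide)

theorem IsGood.exists_hilbertFun_ne_zero {F : q.Filtration M} (hF : F.IsGood)
    (hdim : Module.supportDim R M = 1) (n₀ : ℕ) : ∃ n ≥ n₀, F.hilbertFun n ≠ 0 := by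
  by_contra! hcon
  have h1 : ∀ n ≥ n₀, F.N n₀ ≤ F.N n := fun n hn => by
    induction n, hn using Nat.le_induction with
    | base => exact le_rfl
    | succ n hn ih =>
      exact ih.trans (le_succ_of_hilbertFun_eq_zero (length_quotient_ne_top hq hF.1) (hcon n hn))
  have h2 : q ^ n₀ • (⊤ : Submodule R M) = ⊥ := by
    rw [eq_bot_iff]
    intro x hx
    exact hF.eq_zero_of_forall_mem hq fun n hn => h1 n hn (pow_smul_top_le hF.1 n₀ hx)
  have h3 := Module.supportDim_le_zero_of_pow_smul_eq_bot hq h2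
  rw [hdim] at h3
  exact absurd h3 (by decide)

theorem IsSuperficial.exists_isPostulationNumber_ratliffRush {F : q.Filtration M} (hF : F.IsGood)
    {a b : R} (ha : F.IsSuperficial a) (hreg : IsSMulRegular M a)
    (hM : Module.supportDim R M = 2) (hN : Module.supportDim R N = 1)
    {f : M →ₗ[R] N} (hf : Function.Surjective f)
    (hker : LinearMap.ker f = a • (⊤ : Submodule R M)) (hb : (F.map f).IsSuperficial b) :
    Module.length R (Submodule.torsionBy R N b) ≠ ⊤ ∧ (∃ p, F.IsHPoly p) ∧
      ∃ s : ℤ, F.ratliffRush.IsPostulationNumber s ∧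
        F.hilbertCoeff 2 ≥ -(Ring.choose (s + 2) 2 *
          ((Module.length R (Submodule.torsionBy R N b)).toNat : ℤ)) := by
  obtain ⟨n₁, h₁⟩ := ha.exists_colonElem_eq hF hreg
  have hG := hF.map hf
  have hbfin := hb.length_quotSMulTop_ne_top hq hG hN
  obtain ⟨n₂, h₂⟩ := hb.exists_succ_eq_smul hq hG hbfin
  obtain ⟨n₃, h₃⟩ := hb.exists_torsionBy_inf_eq_bot hq hG
  have hRR0 : F.ratliffRush.N 0 = ⊤ := ratliffRush_zero hF.1
  have hRRfin := length_quotient_ne_top hq hRR0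
  have hGG0 : (F.ratliffRush.map f).N 0 = ⊤ := by
    change (F.ratliffRush.N 0).map f = ⊤
    rw [hRR0, Submodule.map_top, LinearMap.range_eq_top.mpr hf]
  have hGGfin := length_quotient_ne_top hq hGG0
  have hRReq : ∀ n ≥ n₁, F.ratliffRush.N n = F.N n := fun n hn => ratliffRush_eq ha.1 h₁ hn
  have hGGeq : ∀ n ≥ n₁, (F.ratliffRush.map f).N n = (F.map f).N n := fun n hn =>
    congrArg (Submodule.map f) (hRReq n hn)
  obtain ⟨w, hw, hw0⟩ := exists_hilbertFun_add_eq_sum (G := F.ratliffRush.map f) hf hker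
    (fun n => rfl) ha.1 hRR0 hRRfin hGGfin
  have hsum : ∀ n, F.ratliffRush.hilbertFun n =
      ∑ i ∈ Finset.range (n + 1), (F.ratliffRush.map f).hilbertFun i := fun n => by
    rw [← hw, hw0 n (ratliffRush_colonElem ha.1 h₁ n), add_zero]
  obtain ⟨hle, heq⟩ := hilbertFun_add_length_torsionBy hb.1 hGGfin hbfin
  set A := (Module.length R (QuotSMulTop b N)).toNat with hA
  set l := (Module.length R (Submodule.torsionBy R N b)).toNat with hl
  have hJ : ∀ n ≥ n₁ + n₂ + n₃, (F.ratliffRush.map f).hilbertFun n + l = A := fun n hn =>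
    heq n (by rw [hGGeq _ (by omega), hGGeq _ (by omega), h₂ n (by omega)])
      (by rw [hGGeq _ (by omega), h₃ n (by omega)])
  -- This is positivity of the multiplicity `e = A - l`: a Hilbert function vanishing in large
  -- degrees would force dimension at most 0.
  have hpos : l < A := by
    obtain ⟨n, hn, hne⟩ := hG.exists_hilbertFun_ne_zero hq hN (n₁ + n₂ + n₃)
    have h4 := hJ n hn
    have h5 : (F.ratliffRush.map f).hilbertFun n = (F.map f).hilbertFun n := by
      rw [hilbertFun, hilbertFun, hGGeq n (by omega), hGGeq (n + 1) (by omega)]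
    omega
  have hM2 : Module.natDim R M = 2 := Module.natDim_eq hM
  have hJ' : ∀ n ≥ n₁ + n₂ + n₃, (F.ratliffRush.map f).hilbertFun n = A - l := fun n hn => by
    have := hJ n hn
    omega
  obtain ⟨s, hs, hs2⟩ := exists_isPostulationNumber_of_dim_two hM2 hsum hJ'
    (Nat.sub_pos_of_lt hpos) (l := l) (fun n => (hle n).trans (by omega))
  obtain ⟨g, hg⟩ := Polynomial.exists_coe_eq_mk
    (u := fun n => ((A - l : ℕ) : ℤ) - (F.ratliffRush.map f).hilbertFun n) (n₀ := n₁ + n₂ + n₃)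
    (fun n hn => by rw [hJ' n hn, sub_self])
  -- The coefficients computed for the Ratliff–Rush filtration pass to `F`, since the two agree in
  -- large degrees.
  obtain ⟨h6, h7⟩ := (isHPoly_of_dim_two hM2 hsum hg).exists_of_eventually_eq hF.1 hRR0
    (length_quotient_ne_top hq hF.1) hRRfin fun n hn => (hRReq n hn).symm
  refine ⟨length_torsionBy_ne_top (length_quotient_ne_top hq hG.1 n₃) (h₃ n₃ le_rfl), h6, s, hs, ?_⟩
  rwa [h7 2 hM2.ge]

theorem IsSuperficial.hilbertCoeff_eq_of_isSMulRegular {F : q.Filtration M} (hF : F.IsGood)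
    {a : R} (ha : F.IsSuperficial a) (hreg : IsSMulRegular M a) {r : ℕ}
    (hM : Module.supportDim R M = (r + 1 : ℕ)) (hN : Module.supportDim R N = r)
    {f : M →ₗ[R] N} (hf : Function.Surjective f)
    (hker : LinearMap.ker f = a • (⊤ : Submodule R M)) (hp : ∃ p, (F.map f).IsHPoly p) :
    (∃ p, F.IsHPoly p) ∧ ∀ i ≤ r, F.hilbertCoeff i = (F.map f).hilbertCoeff i := by
  obtain ⟨n₁, h₁⟩ := ha.exists_colonElem_eq hF hreg
  obtain ⟨p, hp⟩ := hp
  obtain ⟨w, hw, hw0⟩ := exists_hilbertFun_add_eq_sum (G := F.map f) hf hker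
    (fun n => rfl) ha.1 hF.1 (length_quotient_ne_top hq hF.1)
    (length_quotient_ne_top hq (hF.map hf).1)
  exact hp.exists_of_sum (Module.natDim_eq hM) (Module.natDim_eq hN) hw
    fun n hn => hw0 n (h₁ n hn)

end Ideal.Filtration

/-! ### The quotients by initial segments of the sequence. -/

section Tower

variable {R M : Type*} [CommRing R] [AddCommGroup M] [Module R M] {d : ℕ} (a : Fin d → R)

theorem Ideal.ofFirst_zero : Ideal.ofFirst a 0 = ⊥ := by
  simp [Ideal.ofFirst]

theorem Ideal.ofFirst_succ {k : ℕ} (hk : k < d) :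
    Ideal.ofFirst a (k + 1) = Ideal.ofFirst a k ⊔ Ideal.span {a ⟨k, hk⟩} := by
  rw [Ideal.ofFirst, Ideal.ofFirst, ← Ideal.span_union, ← Set.image_singleton, ← Set.image_union]
  congr 2
  ext j
  simp only [Set.mem_ofPred_eq, Set.mem_union, Set.mem_singleton_iff, Fin.ext_iff]
  omega

theorem Ideal.ofFirst_smul_le_succ (M : Type*) [AddCommGroup M] [Module R M] {k : ℕ}
    (hk : k < d) : Ideal.ofFirst a k • (⊤ : Submodule R M) ≤ Ideal.ofFirst a (k + 1) • ⊤ := by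
  rw [Ideal.ofFirst_succ a hk]
  exact Submodule.smul_mono_left le_sup_left

/-- The projection `M / (a_1, …, a_k) M → M / (a_1, …, a_{k+1}) M`. -/
def Ideal.ofFirstFactor (M : Type*) [AddCommGroup M] [Module R M] {k : ℕ} (hk : k < d) :
    (M ⧸ Ideal.ofFirst a k • (⊤ : Submodule R M)) →ₗ[R]
      (M ⧸ Ideal.ofFirst a (k + 1) • (⊤ : Submodule R M)) :=
  Submodule.factor (Ideal.ofFirst_smul_le_succ a M hk)

theorem Ideal.ofFirstFactor_surjective {k : ℕ} (hk : k < d) :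
    Function.Surjective (Ideal.ofFirstFactor a M hk) :=
  Submodule.factor_surjective (Ideal.ofFirst_smul_le_succ a M hk)

theorem Ideal.ker_ofFirstFactor {k : ℕ} (hk : k < d) :
    LinearMap.ker (Ideal.ofFirstFactor a M hk) = a ⟨k, hk⟩ • ⊤ := by
  have h1 : Ideal.ofFirst a (k + 1) • (⊤ : Submodule R M) =
      Ideal.ofFirst a k • ⊤ ⊔ a ⟨k, hk⟩ • ⊤ := by
    rw [Ideal.ofFirst_succ a hk, Submodule.sup_smul, Submodule.ideal_span_singleton_smul]
  ext y
  obtain ⟨y, rfl⟩ := Submodule.Quotient.mk_surjective _ y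
  rw [LinearMap.mem_ker, Submodule.mem_smul_pointwise_iff_exists]
  change Submodule.Quotient.mk y = (0 : M ⧸ Ideal.ofFirst a (k + 1) • (⊤ : Submodule R M)) ↔ _
  rw [Submodule.Quotient.mk_eq_zero, h1, Submodule.mem_sup]
  constructor
  · rintro ⟨u, hu, v, hv, rfl⟩
    obtain ⟨z, -, rfl⟩ := (Submodule.mem_smul_pointwise_iff_exists _ _ _).mp hv
    refine ⟨Submodule.Quotient.mk z, Submodule.mem_top, ?_⟩
    rw [← Submodule.Quotient.mk_smul, Submodule.Quotient.eq]
    simpa using hu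
  · rintro ⟨z, -, hz⟩
    obtain ⟨z, rfl⟩ := Submodule.Quotient.mk_surjective _ z
    rw [← Submodule.Quotient.mk_smul, Submodule.Quotient.eq] at hz
    refine ⟨y - a ⟨k, hk⟩ • z, ?_, a ⟨k, hk⟩ • z,
      Submodule.smul_mem_pointwise_smul z _ _ Submodule.mem_top, by simp⟩
    rw [← neg_sub]
    exact neg_mem hz

theorem Ideal.Filtration.quotient_map_ofFirstFactor {q : Ideal R} (F : q.Filtration M) {k : ℕ}
    (hk : k < d) :
    (F.quotient (Ideal.ofFirst a k • ⊤)).map (Ideal.ofFirstFactor a M hk) =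
      F.quotient (Ideal.ofFirst a (k + 1) • ⊤) := by
  refine Ideal.Filtration.ext (funext fun n => ?_)
  exact (Submodule.map_comp _ _ _).symm

variable [IsLocalRing R] [IsNoetherianRing R] [Module.Finite R M] {q : Ideal R}
  (hq : q.radical = IsLocalRing.maximalIdeal R) {F : q.Filtration M} (hF : F.IsGood)

include hq hF

-- Any regular sequence of positive length makes the next superficial element regular, and dividing
-- by it lowers depth and dimension by one each, so the induction continues.
variable {a} in
theorem Ideal.Filtration.IsSuperficialSeq.regular_tower {m : ℕ} (hm : d = m + 1)
    (ha : F.IsSuperficialSeq a) (hdim : Module.supportDim R M = d)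
    (hreg : IsLocalRing.HasRegularSeq R M m) {k : ℕ} (hk : k ≤ m) :
    IsLocalRing.HasRegularSeq R (M ⧸ Ideal.ofFirst a k • (⊤ : Submodule R M)) (m - k) ∧
      Module.supportDim R (M ⧸ Ideal.ofFirst a k • (⊤ : Submodule R M)) = (d - k : ℕ) ∧
      ∀ hk' : k < m, IsSMulRegular (M ⧸ Ideal.ofFirst a k • (⊤ : Submodule R M))
        (a ⟨k, by omega⟩) := by
  have key : ∀ {k : ℕ} (hk : k < m),
      IsLocalRing.HasRegularSeq R (M ⧸ Ideal.ofFirst a k • (⊤ : Submodule R M)) (m - k) →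
      IsSMulRegular (M ⧸ Ideal.ofFirst a k • (⊤ : Submodule R M)) (a ⟨k, by omega⟩) := by
    intro k hk h
    obtain ⟨n, hn⟩ : ∃ n, m - k = n + 1 := ⟨m - k - 1, by omega⟩
    rw [hn] at h
    obtain ⟨y, hy, hyreg⟩ := h.exists_isSMulRegular
    exact (ha ⟨k, by omega⟩).isSMulRegular hq (hF.quotient _) hy hyreg
  suffices h : IsLocalRing.HasRegularSeq R (M ⧸ Ideal.ofFirst a k • (⊤ : Submodule R M)) (m - k) ∧
      Module.supportDim R (M ⧸ Ideal.ofFirst a k • (⊤ : Submodule R M)) = (d - k : ℕ) from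
    ⟨h.1, h.2, fun hk' => key hk' h.1⟩
  induction k with
  | zero =>
    have e : (M ⧸ Ideal.ofFirst a 0 • (⊤ : Submodule R M)) ≃ₗ[R] M :=
      Submodule.quotEquivOfEqBot _ (by rw [Ideal.ofFirst_zero, Submodule.bot_smul])
    exact ⟨e.symm.hasRegularSeq hreg, (Module.supportDim_eq_of_equiv e).trans hdim⟩
  | succ k ih =>
    obtain ⟨h1, h2⟩ := ih (by omega) key
    have h3 := key (by omega) h1
    have hkd : k < d := by omega
    have hmem : a ⟨k, hkd⟩ ∈ IsLocalRing.maximalIdeal R := hq ▸ Ideal.le_radical (ha ⟨k, hkd⟩).1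
    have hs := Ideal.ofFirstFactor_surjective (M := M) a hkd
    have hker := Ideal.ker_ofFirstFactor (M := M) a hkd
    rw [show m - k = m - (k + 1) + 1 by omega] at h1
    rw [show d - k = d - (k + 1) + 1 by omega] at h2
    exact ⟨((Ideal.ofFirstFactor a M hkd).quotSMulTopEquiv hs hker).hasRegularSeq
      (h1.quotSMulTop hmem h3),
      Module.supportDim_of_surjective_of_isSMulRegular hs hker h3 hmem h2⟩

end Tower

/-! ### Reduction of the theorem to dimension two. -/

theorem mainTheorem6 {R M : Type*} [CommRing R] [IsLocalRing R] [IsNoetherianRing R]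
    [Infinite (IsLocalRing.ResidueField R)] [AddCommGroup M] [Module R M] [Module.Finite R M]
    (q : Ideal R) (hq : q.radical = IsLocalRing.maximalIdeal R)
    (F : q.Filtration M) (hF : F.IsGood)
    (d : ℕ) (hd : 2 ≤ d) (hdim : Module.supportDim R M = d)
    (hdepth : ((d - 1 : ℕ) : ℕ∞) ≤ IsLocalRing.moduleDepth R M)
    (a : Fin d → R) (ha : F.IsSuperficialSeq a) :
    ∃ (s : ℤ) (l : ℕ),
      (F.quotient (Ideal.ofFirst a (d - 2) • (⊤ : Submodule R M))).ratliffRush.IsPostulationNumber s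
      ∧ ((Ideal.ofFirst a (d - 1) • (⊤ : Submodule R M)).colonElem
            (a ⟨d - 1, by omega⟩)).relLength
          (Ideal.ofFirst a (d - 1) • (⊤ : Submodule R M)) = l
      ∧ F.hilbertCoeff 2 ≥ -(Ring.choose (s + 2) 2 * (l : ℤ)) := by
  obtain ⟨m, rfl⟩ : ∃ m, d = m + 2 := ⟨d - 2, by omega⟩
  have : Nontrivial M := by
    rw [← Module.supportDim_ne_bot_iff_nontrivial R, hdim]
    exact WithBot.coe_ne_bot
  have hreg := IsLocalRing.hasRegularSeq_of_le_moduleDepth (n := m + 1) hdepth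
  have tower : ∀ {k : ℕ} (hk : k ≤ m + 1), _ := fun {k} hk =>
    ha.regular_tower hq hF rfl hdim hreg hk
  have hgood : ∀ k, (F.quotient (Ideal.ofFirst a k • (⊤ : Submodule R M))).IsGood := fun k =>
    hF.quotient _
  obtain ⟨hfin, hpoly, s, hs, hs2⟩ :=
    (ha ⟨m, by omega⟩).exists_isPostulationNumber_ratliffRush hq (hgood m)
      (b := a ⟨m + 1, by omega⟩)
      ((tower (by omega : m ≤ m + 1)).2.2 (by omega))
      ((tower (by omega : m ≤ m + 1)).2.1.trans (by rw [show m + 2 - m = 2 by omega]; rfl))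
      ((tower le_rfl).2.1.trans (by rw [show m + 2 - (m + 1) = 1 by omega]; rfl))
      (Ideal.ofFirstFactor_surjective a (by omega)) (Ideal.ker_ofFirstFactor a (by omega))
      (by
        rw [Ideal.Filtration.quotient_map_ofFirstFactor]
        exact ha ⟨m + 1, by omega⟩)
  refine ⟨s, (Module.length R (Submodule.torsionBy R
    (M ⧸ Ideal.ofFirst a (m + 1) • (⊤ : Submodule R M)) (a ⟨m + 1, by omega⟩))).toNat, hs,
    (Submodule.relLength_colonElem_eq _ _).trans (ENat.natCast_toNat hfin).symm, ?_⟩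
  -- Descent from `M/(a_1, …, a_m)M` to `M`, one element at a time. Existence of the numerator is
  -- carried along, because `hPoly` takes the default value 0 without it.
  have hdown : ∀ j ≤ m,
      (∃ p, (F.quotient (Ideal.ofFirst a (m - j) • (⊤ : Submodule R M))).IsHPoly p) ∧
      (F.quotient (Ideal.ofFirst a (m - j) • (⊤ : Submodule R M))).hilbertCoeff 2 =
        (F.quotient (Ideal.ofFirst a m • (⊤ : Submodule R M))).hilbertCoeff 2 := by
    intro j hj
    induction j with
    | zero => exact ⟨hpoly, rfl⟩
    | succ j ih =>
      obtain ⟨ih1, ih2⟩ := ih (by omega)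
      obtain ⟨k, hk⟩ : ∃ k, m - j = k + 1 := ⟨m - j - 1, by omega⟩
      rw [show m - (j + 1) = k by omega]
      rw [hk, ← Ideal.Filtration.quotient_map_ofFirstFactor a F (by omega : k < m + 2)] at ih1 ih2
      have ht := tower (by omega : k ≤ m + 1)
      have ht' := tower (by omega : k + 1 ≤ m + 1)
      obtain ⟨h1, h2⟩ := (ha ⟨k, by omega⟩).hilbertCoeff_eq_of_isSMulRegular hq (hgood k)
        (ht.2.2 (by omega)) (r := m + 2 - (k + 1))
        (ht.2.1.trans (by rw [show m + 2 - k = m + 2 - (k + 1) + 1 by omega])) ht'.2.1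
        (Ideal.ofFirstFactor_surjective a (by omega)) (Ideal.ker_ofFirstFactor a (by omega)) ih1
      exact ⟨h1, (h2 2 (by omega)).trans ih2⟩
  have h0 := (hdown m le_rfl).2
  rw [Nat.sub_self] at h0
  have hbot : Ideal.ofFirst a 0 • (⊤ : Submodule R M) = ⊥ := by
    rw [Ideal.ofFirst_zero, Submodule.bot_smul]
  -- The descent ends at `M` modulo the zero submodule, which is only isomorphic to `M`; the Hilbert
  -- series is transported along `e`.
  let e : M ≃ₗ[R] (M ⧸ Ideal.ofFirst a 0 • (⊤ : Submodule R M)) :=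
    (Submodule.quotEquivOfEqBot _ hbot).symm
  have hfun := Ideal.Filtration.hilbertFun_eq_of_equiv (F := F)
    (G := F.quotient (Ideal.ofFirst a 0 • (⊤ : Submodule R M))) e (fun n => rfl)
    (Ideal.Filtration.length_quotient_ne_top hq hF.1)
  have hF2 : F.hilbertCoeff 2 =
      (F.quotient (Ideal.ofFirst a 0 • (⊤ : Submodule R M))).hilbertCoeff 2 := by
    obtain ⟨p, hp⟩ := (hdown m le_rfl).1
    rw [Nat.sub_self] at hp
    have hp' : F.IsHPoly p := by
      rw [Ideal.Filtration.IsHPoly, Ideal.Filtration.hilbertSeries, Module.natDim,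
        Module.supportDim_eq_of_equiv e]
      simp only [← hfun]
      exact hp
    rw [Ideal.Filtration.hilbertCoeff, Ideal.Filtration.hilbertCoeff, hp.hPoly_eq, hp'.hPoly_eq]
  rw [hF2, h0]
  exact hs2
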